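/- All graphs are finite and simple. For a graph $H$ and $n\ge 1$, let the rainbow number $rb(K_n,H)$ be the least $m$ such that every edge-colouring of the complete graph $K_n$ using at least $m$ colours contains a rainbow copy of $H$, that is, a subgraph isomorphic to $H$ no two edges of which have the same colour. The cyclomatic number of $H$ is $|E(H)|-|V(H)|+c(H)$, where $c(H)$ is the number of connected components of $H$ (so it is $|E(H)|-|V(H)|+1$ if $H$ is connected). Theorem. Let $H$ be a graph of order $p\ge 5$ and cyclomatic number $1$, containing a cycle with $k$ vertices, where $3\le k\le p-2$. Then for every $n\ge p$, $$\left\lfloor\frac{n}{k-1}\right\rfloor\binom{k-1}{2}+\binom{r}{2}+\left\lceil\frac{n}{k-1}\right\rceil\;\le\; rb(K_n,H)\;\le\;(p-2)n-\frac{p(p-3)}{2},$$ where $r$ is the residue of $n$ modulo $k-1$. In particular, for fixed $H$, $rb(K_n,H)=\Theta(n)$ as $n\to\infty$. -/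

import Mathlib

namespace RainbowNumbers

/-- The cyclomatic number `|E(G)| - |V(G)| + c(G)` of a finite graph `G`, where `c(G)` is the number
of connected components; for a connected graph this is `|E(G)| - |V(G)| + 1`. -/
noncomputable def cyclomaticNumber {V : Type*} (G : SimpleGraph V) : ℤ :=
  (Nat.card G.edgeSet : ℤ) - (Nat.card V : ℤ) + (Nat.card G.ConnectedComponent : ℤ)

theorem cyclomaticNumber_of_connected {V : Type*} (G : SimpleGraph V) (hG : G.Connected) :
    cyclomaticNumber G = (Nat.card G.edgeSet : ℤ) - (Nat.card V : ℤ) + 1 := by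
  have := hG.preconnected.subsingleton_connectedComponent
  have : Nonempty V := hG.nonempty
  have : Nonempty G.ConnectedComponent := ⟨G.connectedComponentMk (Classical.arbitrary V)⟩
  have h : Nat.card G.ConnectedComponent = 1 := Nat.card_eq_one_iff_unique.mpr ⟨‹_›, ‹_›⟩
  rw [cyclomaticNumber, h, Nat.cast_one]

/-- `G` contains a cycle with `k` vertices (equivalently, with `k` edges). -/
def HasCycleOfLength {V : Type*} (G : SimpleGraph V) (k : ℕ) : Prop :=
  ∃ (v : V) (w : G.Walk v v), w.IsCycle ∧ w.length = k

/-- The number of colours that are actually used by an edge-colouring of `K_n`. -/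
noncomputable def numColours {n : ℕ} (c : SimpleGraph.TopEdgeLabeling (Fin n) ℕ) : ℕ :=
  (Set.range c).ncard

/-- The edge-coloured `K_n` contains a rainbow copy of `H`: a subgraph isomorphic to `H`
no two edges of which have the same colour. -/
def HasRainbowCopy {V : Type*} (H : SimpleGraph V) {n : ℕ}
    (c : SimpleGraph.TopEdgeLabeling (Fin n) ℕ) : Prop :=
  ∃ φ : SimpleGraph.Copy H (⊤ : SimpleGraph (Fin n)),
    Function.Injective fun e : H.edgeSet => c (φ.mapEdgeSet e)

/-- The rainbow number `rb(K_n, H)`: the least `m` such that every edge-colouring of `K_n` with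
at least `m` colours contains a rainbow copy of `H`. -/
noncomputable def rainbowNumber {V : Type*} (n : ℕ) (H : SimpleGraph V) : ℕ :=
  sInf {m : ℕ | ∀ c : SimpleGraph.TopEdgeLabeling (Fin n) ℕ, m ≤ numColours c → HasRainbowCopy H c}

end RainbowNumbers

/-! ### Edge and component counts; acyclicity by counting. -/

namespace SimpleGraph

variable {V : Type*}

/-! Upper bound. Removing a cycle edge `xy` from `H` leaves a forest, which lies in a spanning tree
`T`, so `H` is contained in `T + xy`. Call a colour private to `z` in `S` if all its edges within
`S` contain `z`. Induct on the size of `S`: if some vertex has at most `p - 2` private colours,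
delete it; at `p` vertices all colours are distinct. Otherwise every vertex has at least `p - 1`
private colours, and `T` is embedded greedily: the edge from `u` to a new vertex gets a colour
private to `f u` and not yet seen between `f u` and the image (`IsRainbowOn.exists_extend`). The
path closed by `xy` is embedded first, each edge with a colour private to an inner vertex, so `xy`
cannot repeat one.

Lower bound. Cut `K_n` into blocks of size `d = k - 1`, colour edges inside blocks injectively and
each crossing edge by its lower block. A `k`-cycle does not fit in a block, so it leaves and
re-enters its lowest block along two edges of one colour. -/

theorem Reachable.deleteEdge_or {G : SimpleGraph V} {u v a b : V} (h : G.Reachable a b) :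
    (G.deleteEdges {s(u, v)}).Reachable a b ∨
      ((G.deleteEdges {s(u, v)}).Reachable a u ∧ (G.deleteEdges {s(u, v)}).Reachable v b) ∨
      ((G.deleteEdges {s(u, v)}).Reachable a v ∧ (G.deleteEdges {s(u, v)}).Reachable u b) := by
  obtain ⟨w⟩ := h
  induction w with
  | nil => exact Or.inl .rfl
  | @cons a c b hac w ih =>
    by_cases he : s(a, c) = s(u, v)
    · rw [Sym2.eq_iff] at he
      obtain ⟨rfl, rfl⟩ | ⟨rfl, rfl⟩ := he
      · rcases ih with h | ⟨-, h⟩ | ⟨-, h⟩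
        · exact .inr (.inl ⟨.rfl, h⟩)
        · exact .inr (.inl ⟨.rfl, h⟩)
        · exact .inl h
      · rcases ih with h | ⟨-, h⟩ | ⟨-, h⟩
        · exact .inr (.inr ⟨.rfl, h⟩)
        · exact .inl h
        · exact .inr (.inr ⟨.rfl, h⟩)
    · have hr : (G.deleteEdges {s(u, v)}).Reachable a c :=
        Adj.reachable (by rw [deleteEdges_adj]; exact ⟨hac, he⟩)
      rcases ih with h | ⟨h, h'⟩ | ⟨h, h'⟩
      · exact .inl (hr.trans h)
      · exact .inr (.inl ⟨hr.trans h, h'⟩)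
      · exact .inr (.inr ⟨hr.trans h, h'⟩)

theorem card_connectedComponent_deleteEdge_le [Finite V] (G : SimpleGraph V) (u v : V) :
    Nat.card (G.deleteEdges {s(u, v)}).ConnectedComponent ≤ Nat.card G.ConnectedComponent + 1 := by
  classical
  set F := G.deleteEdges {s(u, v)} with hF
  have hle : F ≤ G := deleteEdges_le _
  -- Deletion splits at most one component; sending the part of `u` to `none` makes the map
  -- injective.
  let g : F.ConnectedComponent → Option G.ConnectedComponent := fun c =>
    if c = F.connectedComponentMk u then none else some (c.map (Hom.ofLE hle))
  have hg : Function.Injective g := by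
    intro c d hcd
    induction c using ConnectedComponent.ind with | h a => ?_
    induction d using ConnectedComponent.ind with | h b => ?_
    simp only [g] at hcd
    split_ifs at hcd with h1 h2 h2
    · rw [h1, h2]
    · simp only [Option.some.injEq, ConnectedComponent.map_mk, ConnectedComponent.eq] at hcd
      rw [ConnectedComponent.eq] at h1 h2 ⊢
      rcases Reachable.deleteEdge_or (u := u) (v := v) hcd with h | ⟨h, -⟩ | ⟨-, h⟩
      · exact h
      · exact absurd h h1
      · exact absurd h.symm h2
  have := Nat.card_le_card_of_injective g hg
  rwa [Finite.card_option] at this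

theorem card_connectedComponent_deleteEdge_le_of_reachable [Finite V] {G : SimpleGraph V} {u v : V}
    (h : (G.deleteEdges {s(u, v)}).Reachable u v) :
    Nat.card (G.deleteEdges {s(u, v)}).ConnectedComponent ≤ Nat.card G.ConnectedComponent := by
  refine Nat.card_le_card_of_injective
    (ConnectedComponent.map (Hom.ofLE (deleteEdges_le {s(u, v)}))) ?_
  intro c d hcd
  induction c using ConnectedComponent.ind with | h a => ?_
  induction d using ConnectedComponent.ind with | h b => ?_
  simp only [ConnectedComponent.map_mk, ConnectedComponent.eq] at hcd
  rw [ConnectedComponent.eq]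
  rcases Reachable.deleteEdge_or (u := u) (v := v) hcd with h' | ⟨h1, h2⟩ | ⟨h1, h2⟩
  · exact h'
  · exact (h1.trans h).trans h2
  · exact (h1.trans h.symm).trans h2

theorem card_edgeSet_deleteEdge [Finite V] {G : SimpleGraph V} {e : Sym2 V} (he : e ∈ G.edgeSet) :
    Nat.card (G.deleteEdges {e}).edgeSet + 1 = Nat.card G.edgeSet := by
  rw [Nat.card_coe_set_eq, Nat.card_coe_set_eq, edgeSet_deleteEdges]
  exact Set.ncard_sdiff_singleton_add_one he (Set.toFinite _)

theorem card_le_card_edgeSet_add_card_connectedComponent [Finite V] (G : SimpleGraph V) :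
    Nat.card V ≤ Nat.card G.edgeSet + Nat.card G.ConnectedComponent := by
  induction h : Nat.card G.edgeSet generalizing G with
  | zero =>
    have hbot : G = ⊥ := by
      rw [← edgeSet_eq_empty, ← Set.ncard_eq_zero (Set.toFinite _), ← Nat.card_coe_set_eq, h]
    subst hbot
    rw [Nat.zero_add]
    refine Nat.card_le_card_of_injective (connectedComponentMk ⊥) fun a b hab => ?_
    rwa [ConnectedComponent.eq, reachable_bot] at hab
  | succ m ih =>
    have : Nonempty G.edgeSet := (Nat.card_pos_iff.1 (by omega)).1
    obtain ⟨e, he⟩ := this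
    induction e with | h u v => ?_
    have h1 := card_edgeSet_deleteEdge he
    have h2 := ih (G.deleteEdges {s(u, v)}) (by omega)
    have h3 := card_connectedComponent_deleteEdge_le G u v
    omega

/-- Deleting a non-bridge lowers the edge count without creating a component, which would break the
bound `|V| ≤ |E| + c`. -/
theorem isAcyclic_of_card_edgeSet_add_card_connectedComponent_le [Finite V] {G : SimpleGraph V}
    (h : Nat.card G.edgeSet + Nat.card G.ConnectedComponent ≤ Nat.card V) : G.IsAcyclic := by
  rw [isAcyclic_iff_forall_adj_isBridge]
  intro u v huv
  rw [isBridge_iff]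
  intro hr
  have h1 := card_edgeSet_deleteEdge (G := G) (e := s(u, v)) huv
  have h2 := card_connectedComponent_deleteEdge_le_of_reachable hr
  have h3 := card_le_card_edgeSet_add_card_connectedComponent (G.deleteEdges {s(u, v)})
  omega

end SimpleGraph

/-! ### Unicyclic graphs inside a spanning tree plus an edge. -/

namespace RainbowNumbers

/-- A unicyclic graph with a cycle on `k` vertices is contained in a spanning tree plus one edge
that closes a path with `k` vertices of the tree. -/
theorem exists_isTree_of_cyclomaticNumber_eq_one {V : Type*} [Finite V] {H : SimpleGraph V}
    (hcyc : cyclomaticNumber H = 1) {k : ℕ} (hcycle : HasCycleOfLength H k) :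
    ∃ (T : SimpleGraph V) (x y : V) (q : T.Walk x y), T.IsTree ∧ q.IsPath ∧ q.length + 1 = k ∧
      ∀ a b, H.Adj a b → T.Adj a b ∨ s(a, b) = s(x, y) := by
  obtain ⟨v, w, hw, rfl⟩ := hcycle
  cases w with
  | nil => exact (SimpleGraph.Walk.not_isCycle_nil hw).elim
  | @cons _ x _ h q =>
    obtain ⟨hq, he⟩ := (SimpleGraph.Walk.cons_isCycle_iff q h).1 hw
    set F := H.deleteEdges {s(v, x)} with hF
    have hmem : ∀ e ∈ q.edges, e ∈ F.edgeSet := by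
      intro e he'
      rw [hF, SimpleGraph.edgeSet_deleteEdges]
      refine ⟨q.edges_subset_edgeSet he', ?_⟩
      rintro rfl
      exact he he'
    have hr : F.Reachable v x := ⟨(q.transfer F hmem).reverse⟩
    have hac : F.IsAcyclic := by
      apply SimpleGraph.isAcyclic_of_card_edgeSet_add_card_connectedComponent_le
      have h1 := SimpleGraph.card_edgeSet_deleteEdge (G := H) (e := s(v, x)) h
      have h2 := SimpleGraph.card_connectedComponent_deleteEdge_le_of_reachable hr
      rw [← hF] at h1 h2
      rw [cyclomaticNumber] at hcyc
      omega
    have : Nonempty V := ⟨v⟩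
    -- `H` may be disconnected; the forest `F` is completed to a spanning tree of the complete graph
    -- on `V`.
    obtain ⟨T, hFT, -, hT⟩ :=
      SimpleGraph.connected_top.exists_isTree_le_of_le_of_isAcyclic (H := F) le_top hac
    refine ⟨T, x, v, (q.transfer F hmem).mapLe hFT, hT, ?_, ?_, ?_⟩
    · exact (SimpleGraph.Walk.isPath_mapLe hFT).2 (hq.transfer hmem)
    · simp
    · intro a b hab
      by_cases hs : s(a, b) = s(v, x)
      · right; rw [hs, Sym2.eq_swap]
      · left
        apply hFT
        rw [hF, SimpleGraph.deleteEdges_adj]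
        exact ⟨hab, hs⟩

end RainbowNumbers

/-! ### Private colours and greedy rainbow embeddings. -/

namespace SimpleGraph

variable {V : Type*}

/-- A second neighbour in `A` would give two paths from `v` to `w`: the edge, and a detour through
`A`. Hence a vertex added to a subtree brings only one tree edge. -/
theorem IsAcyclic.eq_of_adj_of_adj_of_preconnected_induce {T : SimpleGraph V} (hT : T.IsAcyclic)
    {A : Set V} (hA : (T.induce A).Preconnected) {u v w : V} (hv : v ∉ A) (hu : u ∈ A) (hw : w ∈ A)
    (hvu : T.Adj v u) (hvw : T.Adj v w) : u = w := by
  obtain ⟨p, hp⟩ := (hA ⟨u, hu⟩ ⟨w, hw⟩).exists_isPath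
  let e := Embedding.induce (G := T) A
  have hp' : (p.map e.toHom).IsPath := hp.map e.injective
  have hnot : v ∉ (p.map e.toHom).support := by
    rw [Walk.support_map, List.mem_map]
    rintro ⟨x, -, rfl⟩
    exact hv x.2
  have h1 : (Walk.cons (show T.Adj v (e.toHom ⟨u, hu⟩) from hvu) (p.map e.toHom)).IsPath :=
    hp'.cons hnot
  have h2 : (Walk.cons (show T.Adj v (e.toHom ⟨w, hw⟩) from hvw) Walk.nil).IsPath :=
    Walk.IsPath.nil.cons (by rw [Walk.support_nil, List.mem_singleton]; exact hvw.ne)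
  have h3 := congrArg (fun q : T.Path v (e.toHom ⟨w, hw⟩) => q.1.length)
    ((hT.subsingleton_path _ _).elim ⟨_, h1⟩ ⟨_, h2⟩)
  simp only [Walk.length_cons, Walk.length_map, Walk.length_nil] at h3
  have := Walk.eq_of_length_eq_zero (p := p) (by omega)
  exact congrArg Subtype.val this

theorem preconnected_induce_insert {T : SimpleGraph V} {A : Set V}
    (hA : (T.induce A).Preconnected) {u v : V} (hu : u ∈ A) (huv : T.Adj u v) :
    (T.induce (insert v A)).Preconnected := by
  rw [Set.insert_eq]
  refine (connected_induce_union (s := {v}) (t := A) (v := v) (w := u) ?_ hA rfl hu huv.symm).preconnected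
  exact Preconnected.of_subsingleton

end SimpleGraph

namespace RainbowNumbers

open Finset SimpleGraph

variable {V W : Type*} [DecidableEq W]

/-- The colours that appear on edges with both ends in `S`. -/
def coloursOn (C : Sym2 W → ℕ) (S : Finset W) : Finset ℕ :=
  (S.sym2.filter fun e => ¬ e.IsDiag).image C

/-- The colours within `S` all of whose edges contain `v`. -/
def privateColours (C : Sym2 W → ℕ) (S : Finset W) (v : W) : Finset ℕ :=
  coloursOn C S \ coloursOn C (S.erase v)

theorem mem_coloursOn {C : Sym2 W → ℕ} {S : Finset W} {x : ℕ} :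
    x ∈ coloursOn C S ↔ ∃ a ∈ S, ∃ b ∈ S, a ≠ b ∧ C s(a, b) = x := by
  simp only [coloursOn, mem_image, mem_filter]
  constructor
  · rintro ⟨e, ⟨he, hd⟩, rfl⟩
    induction e with | h a b => ?_
    rw [mk_mem_sym2_iff] at he
    exact ⟨a, he.1, b, he.2, by simpa using hd, rfl⟩
  · rintro ⟨a, ha, b, hb, hab, rfl⟩
    exact ⟨s(a, b), ⟨by rw [mk_mem_sym2_iff]; exact ⟨ha, hb⟩, by simpa using hab⟩, rfl⟩

theorem eq_or_eq_of_mem_privateColours {C : Sym2 W → ℕ} {S : Finset W} {v a b : W}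
    (ha : a ∈ S) (hb : b ∈ S) (hab : a ≠ b) (h : C s(a, b) ∈ privateColours C S v) :
    v = a ∨ v = b := by
  by_contra! hne
  refine (mem_sdiff.1 h).2 (mem_coloursOn.2 ⟨a, ?_, b, ?_, hab, rfl⟩)
  · exact mem_erase.2 ⟨hne.1.symm, ha⟩
  · exact mem_erase.2 ⟨hne.2.symm, hb⟩

/-- If `u` has at least `|B|` private colours, one of them leads from `u` to outside `B` and avoids
all colours between `u` and `B`. -/
theorem exists_private_edge {C : Sym2 W → ℕ} {S B : Finset W} {u : W} (hu : u ∈ B)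
    (hB : B.card ≤ (privateColours C S u).card) :
    ∃ w ∈ S, w ∉ B ∧ C s(u, w) ∈ privateColours C S u ∧
      ∀ y ∈ B, y ≠ u → C s(u, w) ≠ C s(u, y) := by
  have hlt : ((B.erase u).image fun y => C s(u, y)).card < (privateColours C S u).card := by
    refine card_image_le.trans_lt ?_
    have := card_erase_lt_of_mem hu
    omega
  obtain ⟨x, hx, hxn⟩ := exists_mem_notMem_of_card_lt_card hlt
  obtain ⟨a, ha, b, hb, hab, rfl⟩ := mem_coloursOn.1 (mem_sdiff.1 hx).1
  have key : ∃ w ∈ S, w ≠ u ∧ s(a, b) = s(u, w) := by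
    rcases eq_or_eq_of_mem_privateColours ha hb hab hx with rfl | rfl
    · exact ⟨b, hb, hab.symm, rfl⟩
    · exact ⟨a, ha, hab, Sym2.eq_swap⟩
  obtain ⟨w, hw, hwu, he⟩ := key
  rw [he] at hx hxn
  have hy : ∀ y ∈ B, y ≠ u → C s(u, w) ≠ C s(u, y) := fun y hy hyu h =>
    hxn (mem_image.2 ⟨y, mem_erase.2 ⟨hyu, hy⟩, h.symm⟩)
  exact ⟨w, hw, fun hwB => hy w hwB hwu rfl, hx, hy⟩

/-- `f` embeds the part of `G` within `A` into `S` in such a way that its edges receive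
distinct colours. -/
structure IsRainbowOn (G : SimpleGraph V) (C : Sym2 W → ℕ) (S : Finset W) (A : Set V)
    (f : V → W) : Prop where
  mem : ∀ a ∈ A, f a ∈ S
  injOn : Set.InjOn f A
  rainbow : ∀ a ∈ A, ∀ b ∈ A, ∀ a' ∈ A, ∀ b' ∈ A, G.Adj a b → G.Adj a' b' →
    C s(f a, f b) = C s(f a', f b') → s(a, b) = s(a', b')

/-- As `v` lies outside `A`, the image has at most `|V| - 1` vertices, so `f u` has enough private
colours for `exists_private_edge`. -/
theorem IsRainbowOn.exists_extend [Fintype V] {G : SimpleGraph V} {C : Sym2 W → ℕ} {S : Finset W}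
    {A : Set V} {f : V → W} (hf : IsRainbowOn G C S A f) {u v : V} (hu : u ∈ A) (hv : v ∉ A)
    (huv : ∀ w ∈ A, G.Adj v w → w = u)
    (hS : ∀ z ∈ S, Fintype.card V ≤ (privateColours C S z).card + 1) :
    ∃ g, IsRainbowOn G C S (insert v A) g ∧ (∀ a ∈ A, g a = f a) ∧
      C s(g u, g v) ∈ privateColours C S (g u) := by
  classical
  have hcard : (A.toFinset.image f).card ≤ (privateColours C S (f u)).card := by
    have h1 : A.toFinset.card < Fintype.card V := card_lt_univ_of_notMem (x := v) (by simpa using hv)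
    have h2 := hS (f u) (hf.mem u hu)
    have h3 : (A.toFinset.image f).card ≤ A.toFinset.card := card_image_le
    omega
  obtain ⟨w, hwS, hwB, hw, hy⟩ := exists_private_edge (mem_image.2 ⟨u, by simpa using hu, rfl⟩) hcard
  have hwA : ∀ a ∈ A, f a ≠ w := fun a ha h => hwB (mem_image.2 ⟨a, by simpa using ha, h⟩)
  have hyA : ∀ a ∈ A, a ≠ u → C s(f u, w) ≠ C s(f u, f a) := fun a ha h =>
    hy _ (mem_image.2 ⟨a, by simpa using ha, rfl⟩) fun he => h (hf.injOn ha hu he)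
  let g := Function.update f v w
  have hgv : g v = w := Function.update_self ..
  have hgA : ∀ a ∈ A, g a = f a := fun a ha =>
    Function.update_of_ne (by rintro rfl; exact hv ha) ..
  have hedge : ∀ a ∈ insert v A, ∀ b ∈ insert v A, G.Adj a b →
      (a ∈ A ∧ b ∈ A) ∨ (s(a, b) = s(u, v)) := by
    rintro a (rfl | ha) b (rfl | hb) hab
    · exact absurd hab (G.irrefl)
    · right; rw [huv b hb hab]; exact Sym2.eq_swap
    · right; rw [huv a ha hab.symm]
    · exact .inl ⟨ha, hb⟩
  have hnew : ∀ a b, s(a, b) = s(u, v) → C s(g a, g b) = C s(f u, w) := by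
    intro a b hab
    rw [← Sym2.map_mk, hab, Sym2.map_mk, hgv, hgA u hu]
  -- The new colour is private to `f u`, so only an old edge at `f u` could carry it, and those
  -- colours were avoided.
  have hconf : ∀ a ∈ A, ∀ b ∈ A, G.Adj a b → C s(f a, f b) ≠ C s(f u, w) := by
    intro a ha b hb hab h
    have hne : f a ≠ f b := fun h' => hab.ne (hf.injOn ha hb h')
    rcases eq_or_eq_of_mem_privateColours (hf.mem a ha) (hf.mem b hb) hne (h ▸ hw) with h' | h'
    · obtain rfl := hf.injOn hu ha h'
      exact hyA b hb hab.ne' h.symm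
    · obtain rfl := hf.injOn hu hb h'
      rw [Sym2.eq_swap] at h
      exact hyA a ha hab.ne h.symm
  refine ⟨g, ⟨?_, ?_, ?_⟩, hgA, ?_⟩
  · rintro a (rfl | ha)
    · rwa [hgv]
    · rw [hgA a ha]; exact hf.mem a ha
  · rintro a (rfl | ha) b (rfl | hb) hab
    · rfl
    · rw [hgv, hgA b hb] at hab; exact absurd hab.symm (hwA b hb)
    · rw [hgv, hgA a ha] at hab; exact absurd hab (hwA a ha)
    · rw [hgA a ha, hgA b hb] at hab; exact hf.injOn ha hb hab
  · intro a ha b hb a' ha' b' hb' hab hab' h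
    rcases hedge a ha b hb hab with ⟨h1, h2⟩ | h1 <;> rcases hedge a' ha' b' hb' hab' with ⟨h3, h4⟩ | h3
    · rw [hgA a h1, hgA b h2, hgA a' h3, hgA b' h4] at h
      exact hf.rainbow a h1 b h2 a' h3 b' h4 hab hab' h
    · rw [hgA a h1, hgA b h2, hnew _ _ h3] at h
      exact absurd h (hconf a h1 b h2 hab)
    · rw [hgA a' h3, hgA b' h4, hnew _ _ h1] at h
      exact absurd h.symm (hconf a' h3 b' h4 hab')
    · rw [h1, h3]
  · rw [hgv, hgA u hu]; exact hw

/-- An initial segment of a path of a tree has a rainbow embedding in which the colour of every edge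
is private to the image of an inner vertex of the path. -/
theorem exists_isRainbowOn_path [Fintype V] {T : SimpleGraph V} (hT : T.IsAcyclic)
    {C : Sym2 W → ℕ} {S : Finset W} (hne : S.Nonempty)
    (hS : ∀ z ∈ S, Fintype.card V ≤ (privateColours C S z).card + 1)
    {x y : V} (q : T.Walk x y) (hq : q.IsPath) (hlen : 2 ≤ q.length) (j : ℕ) (hj : j + 1 ≤ q.length) :
    ∃ f, IsRainbowOn T C S (q.getVert '' Set.Iic (j + 1)) f ∧
      (T.induce (q.getVert '' Set.Iic (j + 1))).Preconnected ∧
      ∀ a ∈ q.getVert '' Set.Iic (j + 1), ∀ b ∈ q.getVert '' Set.Iic (j + 1), T.Adj a b →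
        ∃ z ∈ s(a, b), z ≠ x ∧ z ≠ y ∧ z ∈ q.getVert '' Set.Iic (j + 1) ∧
          C s(f a, f b) ∈ privateColours C S (f z) := by
  have hinj := hq.getVert_injOn
  have hinterior : ∀ i, 1 ≤ i → i < q.length → q.getVert i ≠ x ∧ q.getVert i ≠ y := by
    intro i h1 h2
    constructor
    · intro h
      have := (hq.getVert_eq_start_iff h2.le).1 h
      omega
    · intro h
      have := (hq.getVert_eq_end_iff h2.le).1 h
      omega
  have step : ∀ (A : Set V) (f : V → W) (u v : V), IsRainbowOn T C S A f →
      (T.induce A).Preconnected →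
      (∀ a ∈ A, ∀ b ∈ A, T.Adj a b → ∃ z ∈ s(a, b), z ≠ x ∧ z ≠ y ∧ z ∈ A ∧
          C s(f a, f b) ∈ privateColours C S (f z)) →
      u ∈ A → v ∉ A → T.Adj u v → u ≠ x → u ≠ y →
      ∃ g, IsRainbowOn T C S (insert v A) g ∧ (T.induce (insert v A)).Preconnected ∧
        ∀ a ∈ insert v A, ∀ b ∈ insert v A, T.Adj a b →
          ∃ z ∈ s(a, b), z ≠ x ∧ z ≠ y ∧ z ∈ insert v A ∧
            C s(g a, g b) ∈ privateColours C S (g z) := by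
    intro A f u v hf hA hpriv hu hv huv hux huy
    have huniq : ∀ w ∈ A, T.Adj v w → w = u := fun w hw hvw =>
      hT.eq_of_adj_of_adj_of_preconnected_induce hA hv hw hu hvw huv.symm
    obtain ⟨g, hg, hgA, hgu⟩ := hf.exists_extend hu hv huniq hS
    refine ⟨g, hg, preconnected_induce_insert hA hu huv, ?_⟩
    rintro a (rfl | ha) b (rfl | hb) hab
    · exact absurd hab T.irrefl
    · obtain rfl := huniq b hb hab
      exact ⟨b, by simp, hux, huy, .inr hu, by rwa [Sym2.eq_swap]⟩
    · obtain rfl := huniq a ha hab.symm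
      exact ⟨a, by simp, hux, huy, .inr hu, hgu⟩
    · obtain ⟨z, hz, h1, h2, h3, h4⟩ := hpriv a ha b hb hab
      refine ⟨z, hz, h1, h2, .inr h3, ?_⟩
      rwa [hgA a ha, hgA b hb, hgA z h3]
  induction j with
  | zero =>
    obtain ⟨s, hs⟩ := hne
    have h01 : q.getVert '' Set.Iic (0 + 1) = insert (q.getVert 0) {q.getVert 1} := by
      ext a
      simp only [Set.mem_image, Set.mem_Iic, Set.mem_insert_iff, Set.mem_singleton_iff]
      constructor
      · rintro ⟨i, hi, rfl⟩
        interval_cases i <;> simp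
      · rintro (rfl | rfl)
        · exact ⟨0, by omega, rfl⟩
        · exact ⟨1, by omega, rfl⟩
    rw [h01]
    have hadj := q.adj_getVert_succ (i := 0) (by omega)
    -- The embedding starts at the inner vertex `q.getVert 1`, with the endpoint `x` hung from it,
    -- so that the first edge too has a colour private to an inner vertex.
    refine step _ (fun _ => s) (q.getVert 1) (q.getVert 0) ⟨fun _ _ => hs, ?_, ?_⟩ ?_ ?_ rfl
      (fun h => hadj.ne h) hadj.symm (hinterior 1 le_rfl (by omega)).1
      (hinterior 1 le_rfl (by omega)).2
    · exact Set.injOn_singleton _ _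
    · rintro a rfl b rfl a' - b' - h
      exact absurd h T.irrefl
    · exact Preconnected.of_subsingleton
    · rintro a rfl b rfl h
      exact absurd h T.irrefl
  | succ j ih =>
    obtain ⟨f, hf, hA, hpriv⟩ := ih (by omega)
    have hins : q.getVert '' Set.Iic (j + 1 + 1) =
        insert (q.getVert (j + 1 + 1)) (q.getVert '' Set.Iic (j + 1)) := by
      rw [← Set.image_insert_eq]
      congr 1
      ext i
      simp only [Set.mem_Iic, Set.mem_insert_iff]
      omega
    rw [hins]
    refine step _ f (q.getVert (j + 1)) _ hf hA hpriv ⟨j + 1, Set.self_mem_Iic, rfl⟩ ?_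
      (q.adj_getVert_succ (by omega)) (hinterior _ (by omega) (by omega)).1
      (hinterior _ (by omega) (by omega)).2
    rintro ⟨i, hi, h⟩
    have hi : i ≤ j + 1 := hi
    have := hinj (show i ≤ q.length by omega) (show j + 1 + 1 ≤ q.length by omega) h
    omega

/-- Once the cycle is embedded, every further vertex is attached by a single tree edge, and the
greedy step finishes. -/
theorem exists_isRainbowOn_univ_of_private [Fintype V] {T H : SimpleGraph V} (hT : T.IsTree)
    {C : Sym2 W → ℕ} {S : Finset W} (hne : S.Nonempty)
    (hS : ∀ z ∈ S, Fintype.card V ≤ (privateColours C S z).card + 1)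
    {x y : V} (q : T.Walk x y) (hq : q.IsPath) (hlen : 2 ≤ q.length)
    (hH : ∀ a b, H.Adj a b → T.Adj a b ∨ s(a, b) = s(x, y)) :
    ∃ f, IsRainbowOn H C S Set.univ f := by
  classical
  have grow : ∀ (m : ℕ) (A : Set V) (f : V → W), Aᶜ.ncard = m → IsRainbowOn H C S A f →
      (T.induce A).Preconnected → x ∈ A → y ∈ A → ∃ f, IsRainbowOn H C S Set.univ f := by
    intro m
    induction m with
    | zero =>
      intro A f hm hf _ _ _
      rw [Set.ncard_eq_zero (Set.toFinite _), Set.compl_empty_iff] at hm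
      exact ⟨f, hm ▸ hf⟩
    | succ m ih =>
      intro A f hm hf hA hx hy
      obtain ⟨v, hv⟩ := Set.nonempty_of_ncard_ne_zero (s := Aᶜ) (by omega)
      obtain ⟨d, -, hd1, hd2⟩ := (hT.connected x v).some.exists_boundary_dart A hx hv
      -- The extra edge `xy` already has both ends in `A`, so it cannot reach the new vertex.
      have huniq : ∀ w ∈ A, H.Adj d.snd w → w = d.fst := by
        intro w hw hvw
        rcases hH _ _ hvw with h | h
        · exact hT.isAcyclic.eq_of_adj_of_adj_of_preconnected_induce hA hd2 hw hd1 h d.adj.symm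
        · rw [Sym2.eq_iff] at h
          rcases h with ⟨h, -⟩ | ⟨h, -⟩
          · exact absurd (h ▸ hx) hd2
          · exact absurd (h ▸ hy) hd2
      obtain ⟨g, hg, -⟩ := hf.exists_extend hd1 hd2 huniq hS
      refine ih _ g ?_ hg (preconnected_induce_insert hA hd1 d.adj) (.inr hx) (.inr hy)
      have : (insert d.snd A)ᶜ = Aᶜ \ {d.snd} := by
        ext z; simp [not_or, and_comm]
      rw [this, Set.ncard_sdiff_singleton_of_mem hd2, hm]
      rfl
  obtain ⟨f, hf, hA, hpriv⟩ := exists_isRainbowOn_path hT.isAcyclic hne hS q hq hlen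
    (q.length - 1) (by omega)
  set A := q.getVert '' Set.Iic (q.length - 1 + 1) with hAdef
  have hx : x ∈ A := ⟨0, by simp, by simp⟩
  have hy : y ∈ A := ⟨q.length, by simp only [Set.mem_Iic]; omega, by simp⟩
  have hxy : x ≠ y := by
    intro h
    have := (hq.getVert_eq_end_iff (i := 0) (by omega)).1 (by simpa using h)
    omega
  -- A path edge's colour is private to the image of an inner vertex, which is not an end of the
  -- closing edge.
  have hclose : ∀ a ∈ A, ∀ b ∈ A, T.Adj a b → C s(f a, f b) ≠ C s(f x, f y) := by
    intro a ha b hb hab h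
    obtain ⟨z, -, hzx, hzy, hzA, hz⟩ := hpriv a ha b hb hab
    rw [h] at hz
    rcases eq_or_eq_of_mem_privateColours (hf.mem x hx) (hf.mem y hy)
      (fun h' => hxy (hf.injOn hx hy h')) hz with h' | h'
    · exact hzx (hf.injOn hzA hx h')
    · exact hzy (hf.injOn hzA hy h')
  have hcol : ∀ a b, s(a, b) = s(x, y) → C s(f a, f b) = C s(f x, f y) := by
    intro a b hab
    rw [← Sym2.map_mk, hab, Sym2.map_mk]
  refine grow _ A f rfl ⟨hf.mem, hf.injOn, ?_⟩ hA hx hy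
  intro a ha b hb a' ha' b' hb' hab hab' h
  rcases hH _ _ hab with h1 | h1 <;> rcases hH _ _ hab' with h2 | h2
  · exact hf.rainbow a ha b hb a' ha' b' hb' h1 h2 h
  · rw [hcol _ _ h2] at h
    exact absurd h (hclose a ha b hb h1)
  · rw [hcol _ _ h1] at h
    exact absurd h.symm (hclose a' ha' b' hb' h2)
  · rw [h1, h2]

/-- Enough colours inside `S` force a rainbow embedding into `S`. -/
theorem exists_isRainbowOn_univ [Fintype V] {T H : SimpleGraph V} (hT : T.IsTree)
    {C : Sym2 W → ℕ} {x y : V} (q : T.Walk x y) (hq : q.IsPath) (hlen : 2 ≤ q.length)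
    (hH : ∀ a b, H.Adj a b → T.Adj a b ∨ s(a, b) = s(x, y)) (d : ℕ) (S : Finset W)
    (hSd : S.card = Fintype.card V + d)
    (hcol : (Fintype.card V).choose 2 + d * (Fintype.card V - 2) ≤ (coloursOn C S).card) :
    ∃ f, IsRainbowOn H C S Set.univ f := by
  induction d generalizing S with
  | zero =>
    have hcardE : (S.sym2.filter fun e => ¬ e.IsDiag).card = (Fintype.card V).choose 2 := by
      rw [← Nat.add_zero (Fintype.card V), ← hSd, ← Sym2.card_image_offDiag]
      congr 1
      ext e
      induction e with | h a b => ?_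
      simp only [mem_filter, mk_mem_sym2_iff, Sym2.mk_isDiag_iff, mem_image, mem_offDiag,
        Prod.exists, Function.uncurry_apply_pair]
      constructor
      · rintro ⟨⟨ha, hb⟩, hab⟩
        exact ⟨a, b, ⟨ha, hb, hab⟩, rfl⟩
      · rintro ⟨c, d, ⟨hc, hd, hcd⟩, h⟩
        rcases Sym2.eq_iff.1 h with ⟨rfl, rfl⟩ | ⟨rfl, rfl⟩
        · exact ⟨⟨hc, hd⟩, hcd⟩
        · exact ⟨⟨hd, hc⟩, hcd.symm⟩
    -- There are as many colours as edges, so any bijection onto `S` is rainbow.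
    have hinj : Set.InjOn C (S.sym2.filter fun e => ¬ e.IsDiag) := by
      refine card_image_iff.1 (le_antisymm card_image_le ?_)
      rw [hcardE]
      have : (S.sym2.filter fun e => ¬ e.IsDiag).image C = coloursOn C S := rfl
      rw [this]; omega
    have e : V ≃ S := Fintype.equivOfCardEq (by rw [Fintype.card_coe, hSd, Nat.add_zero])
    have he : Function.Injective fun v => (e v : W) := Subtype.val_injective.comp e.injective
    refine ⟨fun v => (e v : W), fun v _ => (e v).2, he.injOn, ?_⟩
    intro a _ b _ a' _ b' _ hab hab' h
    have hmem : ∀ a b, H.Adj a b →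
        s((e a : W), (e b : W)) ∈ (↑(S.sym2.filter fun e => ¬ e.IsDiag) : Set (Sym2 W)) := by
      intro a b hab
      rw [mem_coe, mem_filter, mk_mem_sym2_iff]
      exact ⟨⟨(e a).2, (e b).2⟩, fun h => hab.ne (he h)⟩
    exact Sym2.map.injective he (hinj (hmem _ _ hab) (hmem _ _ hab') h)
  | succ d ih =>
    by_cases hS : ∀ z ∈ S, Fintype.card V ≤ (privateColours C S z).card + 1
    · exact exists_isRainbowOn_univ_of_private hT (card_pos.1 (by omega)) hS q hq hlen hH
    · push Not at hS
      obtain ⟨z, hz, hzc⟩ := hS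
      -- Deleting `z` loses exactly its private colours, at most `|V| - 2` of them.
      obtain ⟨f, hf⟩ := ih (S.erase z) (by rw [card_erase_of_mem hz, hSd]; rfl) (by
        have h1 := le_card_sdiff (coloursOn C (S.erase z)) (coloursOn C S)
        have h2 : (privateColours C S z).card = (coloursOn C S \ coloursOn C (S.erase z)).card := rfl
        rw [Nat.succ_mul] at hcol
        omega)
      exact ⟨f, fun a ha => mem_of_mem_erase (hf.mem a ha), hf.injOn, hf.rainbow⟩

end RainbowNumbers

/-! ### The block colouring and the lower bound. -/

namespace RainbowNumbers

open Finset SimpleGraph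

/-- The numbers in blocks `[i * d, (i + 1) * d)`: pairs in one block get their own colours, and
pairs that meet two blocks get a colour that encodes the first of these. -/
def blockColour (d : ℕ) : Sym2 ℕ → ℕ :=
  Sym2.lift ⟨fun a b => if a / d = b / d then 2 * Nat.pair (min a b) (max a b)
    else 2 * min (a / d) (b / d) + 1, fun a b => by
      simp only [min_comm b a, max_comm b a, min_comm (b / d), eq_comm (a := b / d)]⟩

theorem blockColour_of_eq {d a b : ℕ} (hab : a ≤ b) (h : a / d = b / d) :
    blockColour d s(a, b) = 2 * Nat.pair a b := by
  simp [blockColour, h, hab]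

theorem blockColour_of_lt {d a b : ℕ} (h : a / d < b / d) :
    blockColour d s(a, b) = 2 * (a / d) + 1 := by
  simp [blockColour, h.ne, h.le]

/-- The edge-colouring of `K_n` given by `blockColour`. -/
def blockLabeling (n d : ℕ) : TopEdgeLabeling (Fin n) ℕ :=
  fun e => blockColour d (e.1.map Fin.val)

theorem exists_true_false_step {P : ℕ → Prop} {i j : ℕ} (hij : i ≤ j) (hi : P i) (hj : ¬ P j) :
    ∃ s, i ≤ s ∧ s < j ∧ P s ∧ ¬ P (s + 1) := by
  induction j, hij using Nat.le_induction with
  | base => exact absurd hi hj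
  | succ j hij ih =>
    by_cases h : P j
    · exact ⟨j, hij, by omega, h, hj⟩
    · obtain ⟨s, h1, h2, h3⟩ := ih h
      exact ⟨s, h1, by omega, h3⟩

theorem not_hasRainbowCopy_blockLabeling {V : Type*} {H : SimpleGraph V} {n d : ℕ} (hd : 0 < d)
    (hcycle : HasCycleOfLength H (d + 1)) : ¬ HasRainbowCopy H (blockLabeling n d) := by
  classical
  rintro ⟨φ, hφ⟩
  obtain ⟨v, w, hw, hlen⟩ := hcycle
  let β : V → ℕ := fun v => (φ v).val / d
  -- The cycle is rotated to start in its lowest block, so that each edge leaving that block has the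
  -- colour of that block.
  obtain ⟨u, hu, hmin⟩ := exists_min_image w.support.toFinset β ⟨v, by simp⟩
  rw [List.mem_toFinset] at hu
  set c := w.rotate u hu with hc
  have hcc : c.IsCycle := hw.rotate hu
  have hclen : c.length = d + 1 := by rw [hc, Walk.length_rotate, hlen]
  have hmin' : ∀ i, β u ≤ β (c.getVert i) := by
    intro i
    apply hmin
    rw [List.mem_toFinset]
    exact (Walk.mem_support_rotate_iff _ _ hu).1 (c.getVert_mem_support i)
  have hout : ∃ j ≤ c.length, β (c.getVert j) ≠ β u := by
    by_contra! hall
    have hinj : Set.InjOn (fun i => (φ (c.getVert i)).val) (range (d + 1)) := by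
      intro i hi j hj hij
      rw [coe_range, Set.mem_Iio] at hi hj
      exact hcc.getVert_injOn' (by simp only [Set.mem_ofPred_eq]; omega)
        (by simp only [Set.mem_ofPred_eq]; omega) (φ.injective (Fin.val_injective hij))
    have hcard := card_le_card_of_injOn (t := Ico (β u * d) (β u * d + d)) _ (fun i hi => ?_) hinj
    · simp at hcard
    · rw [mem_coe, mem_range] at hi
      have h := hall i (by omega)
      rw [Nat.div_eq_iff hd] at h
      rw [mem_coe, mem_Ico]
      omega
  obtain ⟨j, hj, hjne⟩ := hout
  obtain ⟨s, -, hsj, hs1, hs2⟩ := exists_true_false_step (P := fun i => β (c.getVert i) = β u)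
    (Nat.zero_le j) (by simp) hjne
  obtain ⟨t, hjt, htl, ht1, ht2⟩ := exists_true_false_step (P := fun i => β (c.getVert i) ≠ β u)
    hj hjne (by simp)
  rw [not_not] at ht2
  have hcol : ∀ a b (h : H.Adj a b), β a = β u → β u < β b →
      blockLabeling n d (φ.mapEdgeSet ⟨s(a, b), h⟩) = 2 * β u + 1 := by
    intro a b h ha hb
    rw [← ha]
    exact blockColour_of_lt (show β a < β b from ha ▸ hb)
  have hadj1 := c.adj_getVert_succ (i := s) (by omega)
  have hadj2 := (c.adj_getVert_succ htl).symm
  have h1 := hcol _ _ hadj1 hs1 (lt_of_le_of_ne (hmin' _) (Ne.symm hs2))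
  have h2 := hcol _ _ hadj2 ht2 (lt_of_le_of_ne (hmin' _) (Ne.symm ht1))
  have heq := congrArg Subtype.val (hφ (h1.trans h2.symm))
  -- If the exit and return edges coincided, the cycle would either backtrack at once or have a
  -- vertex both inside and outside the lowest block.
  rcases Sym2.eq_iff.1 heq with ⟨h3, h4⟩ | ⟨h3, -⟩
  · have hst : s + 1 = t := hcc.getVert_injOn (by simp only [Set.mem_ofPred_eq]; omega)
      (by simp only [Set.mem_ofPred_eq]; omega) h4
    subst hst
    exact hcc.getVert_sub_one_ne_getVert_add_one (i := s + 1) (by omega) h3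
  · exact ht1 (h3 ▸ hs1)

/-- Counts pairs inside blocks by larger element: `b` has `b % d` predecessors in its block. -/
theorem sum_range_mod {d : ℕ} (hd : 0 < d) (n : ℕ) :
    ∑ b ∈ range n, b % d = n / d * d.choose 2 + (n % d).choose 2 := by
  have hblock : ∀ q r, r ≤ d → ∑ b ∈ range (d * q + r), b % d =
      ∑ b ∈ range (d * q), b % d + r.choose 2 := by
    intro q r hr
    rw [sum_range_add]
    congr 1
    rw [Nat.choose_two_right, ← sum_range_id]
    refine sum_congr rfl fun x hx => ?_
    rw [mem_range] at hx
    rw [Nat.mul_add_mod, Nat.mod_eq_of_lt (by omega)]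
  have hfull : ∀ q, ∑ b ∈ range (d * q), b % d = q * d.choose 2 := by
    intro q
    induction q with
    | zero => simp
    | succ q ih => rw [Nat.mul_succ, hblock q d le_rfl, ih, Nat.succ_mul]
  conv_lhs => rw [← Nat.div_add_mod n d]
  rw [hblock _ _ (Nat.mod_lt _ hd).le, hfull]

theorem le_numColours_blockLabeling {n d : ℕ} (hd : 0 < d) :
    n / d * d.choose 2 + (n % d).choose 2 + (n - 1) / d ≤ numColours (blockLabeling n d) := by
  let E : Finset ℕ := ((range n).sigma fun b => Ico (b - b % d) b).image
    fun x => 2 * Nat.pair x.2 x.1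
  let F : Finset ℕ := (range ((n - 1) / d)).image fun i => 2 * i + 1
  have hE : E.card = n / d * d.choose 2 + (n % d).choose 2 := by
    rw [card_image_of_injective, card_sigma, ← sum_range_mod hd]
    · refine sum_congr rfl fun b _ => ?_
      rw [Nat.card_Ico]
      have := Nat.mod_le b d
      omega
    · rintro ⟨b, a⟩ ⟨b', a'⟩ h
      have h' := Nat.pair_eq_pair.1 (Nat.eq_of_mul_eq_mul_left two_pos h)
      obtain ⟨rfl, rfl⟩ := h'
      rfl
  have hF : F.card = (n - 1) / d := by
    rw [card_image_of_injective, card_range]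
    intro i j h
    simp only at h
    omega
  have hdisj : Disjoint E F := by
    rw [Finset.disjoint_left]
    intro x hx hx'
    obtain ⟨y, -, rfl⟩ := mem_image.1 hx
    obtain ⟨i, -, h⟩ := mem_image.1 hx'
    omega
  have hmem : ∀ a b, a < b → b < n →
      blockColour d s(a, b) ∈ Set.range (blockLabeling n d) := by
    intro a b hab hb
    exact ⟨⟨s(⟨a, by omega⟩, ⟨b, hb⟩), by simp [hab.ne]⟩, rfl⟩
  have hsub : (↑(E ∪ F) : Set ℕ) ⊆ Set.range (blockLabeling n d) := by
    intro x hx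
    rw [mem_coe, mem_union] at hx
    rcases hx with hx | hx
    · obtain ⟨⟨b, a⟩, h, rfl⟩ := mem_image.1 hx
      rw [mem_sigma, mem_range, mem_Ico] at h
      obtain ⟨hb, hba, hab⟩ := h
      simp only at hba hab hb
      have hdiv : a / d = b / d := by
        refine le_antisymm (Nat.div_le_div_right hab.le) ?_
        rw [Nat.le_div_iff_mul_le hd]
        have := Nat.div_add_mod' b d
        omega
      rw [← blockColour_of_eq hab.le hdiv]
      exact hmem a b hab hb
    · obtain ⟨i, hi, rfl⟩ := mem_image.1 hx
      rw [mem_range] at hi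
      have hi' : i * d / d = i := Nat.mul_div_cancel _ hd
      have hlt : i * d / d < (n - 1) / d := by rwa [hi']
      have hlt' : i * d < n - 1 := by
        by_contra! h
        exact absurd hlt (not_lt.2 (Nat.div_le_div_right h))
      -- Each block before the last one has a crossing edge from its first element to `n - 1`.
      have := hmem (i * d) (n - 1) hlt' (by omega)
      rwa [blockColour_of_lt hlt, hi'] at this
  rw [← hE, ← hF, ← card_union_of_disjoint hdisj, ← Set.ncard_coe_finset]
  exact Set.ncard_le_ncard hsub (Set.finite_range _)

/-! ### The two bounds on the rainbow number. -/

theorem hasRainbowCopy_of_le_numColours {V : Type*} [Fintype V] {H : SimpleGraph V}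
    (hcyc : cyclomaticNumber H = 1) {k : ℕ} (hk : 3 ≤ k) (hcycle : HasCycleOfLength H k) {n : ℕ}
    (hn : Fintype.card V ≤ n) (c : TopEdgeLabeling (Fin n) ℕ)
    (hc : (Fintype.card V).choose 2 + (n - Fintype.card V) * (Fintype.card V - 2) ≤ numColours c) :
    HasRainbowCopy H c := by
  classical
  obtain ⟨T, x, y, q, hT, hq, hlen, hH⟩ := exists_isTree_of_cyclomaticNumber_eq_one hcyc hcycle
  -- The value 0 on the diagonal is harmless, since `coloursOn` ignores diagonal pairs.
  let C : Sym2 (Fin n) → ℕ := fun e =>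
    if h : e ∈ (⊤ : SimpleGraph (Fin n)).edgeSet then c ⟨e, h⟩ else 0
  have hC : ∀ e : (⊤ : SimpleGraph (Fin n)).edgeSet, C e = c e := fun e => dif_pos e.2
  have hle : numColours c ≤ (coloursOn C univ).card := by
    rw [numColours, ← Set.ncard_coe_finset]
    refine Set.ncard_le_ncard ?_ (Set.toFinite _)
    rintro _ ⟨⟨e, he⟩, rfl⟩
    induction e with | h a b => ?_
    rw [mem_coe, mem_coloursOn]
    exact ⟨a, mem_univ _, b, mem_univ _, he, hC ⟨s(a, b), he⟩⟩
  obtain ⟨f, hf⟩ := exists_isRainbowOn_univ hT q hq (by omega) hH (n - Fintype.card V) univ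
    (by rw [card_univ, Fintype.card_fin]; omega) (hc.trans hle)
  have hinj : Function.Injective f := Set.injOn_univ.1 hf.injOn
  refine ⟨⟨⟨f, fun h => hinj.ne h.ne⟩, hinj⟩, ?_⟩
  rintro ⟨e, he⟩ ⟨e', he'⟩ h
  induction e with | h a b => ?_
  induction e' with | h a' b' => ?_
  simp only [← hC] at h
  exact Subtype.ext (hf.rainbow a trivial b trivial a' trivial b' trivial he he' h)

theorem rainbowNumber_le {V : Type*} [Fintype V] {H : SimpleGraph V}
    (hcyc : cyclomaticNumber H = 1) {k : ℕ} (hk : 3 ≤ k) (hcycle : HasCycleOfLength H k) {n : ℕ}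
    (hn : Fintype.card V ≤ n) :
    rainbowNumber n H ≤
      (Fintype.card V).choose 2 + (n - Fintype.card V) * (Fintype.card V - 2) :=
  Nat.sInf_le fun c hc => hasRainbowCopy_of_le_numColours hcyc hk hcycle hn c hc

theorem le_rainbowNumber {V : Type*} [Fintype V] {H : SimpleGraph V}
    (hcyc : cyclomaticNumber H = 1) {d : ℕ} (hd : 2 ≤ d) (hcycle : HasCycleOfLength H (d + 1))
    {n : ℕ} (hn : Fintype.card V ≤ n) :
    n / d * d.choose 2 + (n % d).choose 2 + ((n - 1) / d + 1) ≤ rainbowNumber n H := by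
  -- The upper bound shows that the set is nonempty; otherwise `sInf` would be 0.
  refine le_csInf ⟨_, fun c hc =>
    hasRainbowCopy_of_le_numColours hcyc (by omega) hcycle hn c hc⟩ fun m hm => ?_
  by_contra! hlt
  have h := le_numColours_blockLabeling (n := n) (d := d) (by omega)
  exact not_hasRainbowCopy_blockLabeling (by omega) hcycle (hm _ (by omega))

theorem natCeil_div_eq {n d : ℕ} (hn : 0 < n) (hd : 0 < d) :
    ⌈(n : ℚ) / d⌉₊ = (n - 1) / d + 1 := by
  have hd' : (0 : ℚ) < d := by exact_mod_cast hd
  apply le_antisymm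
  · rw [Nat.ceil_le, div_le_iff₀ hd']
    have := Nat.lt_div_mul_add (a := n - 1) hd
    have h : n ≤ ((n - 1) / d + 1) * d := by rw [add_mul, one_mul]; omega
    exact_mod_cast h
  · rw [Nat.succ_le_iff, Nat.lt_ceil, lt_div_iff₀ hd']
    have := Nat.div_mul_le_self (n - 1) d
    have h : (n - 1) / d * d < n := by omega
    exact_mod_cast h

end RainbowNumbers

theorem theoremt5 {V : Type*} [Fintype V] (H : SimpleGraph V) (p k : ℕ)
    (hcard : Fintype.card V = p) (hp : 5 ≤ p)
    (hcyc : RainbowNumbers.cyclomaticNumber H = 1)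
    (hk3 : 3 ≤ k) (hkp : k ≤ p - 2)
    (hcycle : RainbowNumbers.HasCycleOfLength H k) :
    (∀ n : ℕ, p ≤ n →
      ⌊(n : ℚ) / ((k : ℚ) - 1)⌋₊ * (k - 1).choose 2 + (n % (k - 1)).choose 2
          + ⌈(n : ℚ) / ((k : ℚ) - 1)⌉₊ ≤ RainbowNumbers.rainbowNumber n H ∧
      (RainbowNumbers.rainbowNumber n H : ℚ) ≤
        ((p : ℚ) - 2) * (n : ℚ) - (p : ℚ) * (((p : ℚ) - 3) / 2)) ∧
    (fun n : ℕ => (RainbowNumbers.rainbowNumber n H : ℝ)) =Θ[Filter.atTop]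
      (fun n : ℕ => (n : ℝ)) := by
  obtain ⟨d, rfl⟩ : ∃ d, k = d + 1 := ⟨k - 1, by omega⟩
  subst hcard
  set p := Fintype.card V with hpdef
  have hlower := fun n (hn : p ≤ n) =>
    RainbowNumbers.le_rainbowNumber hcyc (by omega) hcycle hn
  have hupper := fun n (hn : p ≤ n) => RainbowNumbers.rainbowNumber_le hcyc hk3 hcycle hn
  refine ⟨fun n hn => ⟨?_, ?_⟩, ?_, ?_⟩
  · rw [Nat.cast_add_one, add_sub_cancel_right, Nat.add_sub_cancel,
      RainbowNumbers.natCeil_div_eq (by omega) (by omega), Nat.floor_div_eq_div]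
    exact hlower n hn
  · have h : (RainbowNumbers.rainbowNumber n H : ℚ) ≤
        ((p.choose 2 + (n - p) * (p - 2) : ℕ) : ℚ) := by exact_mod_cast hupper n hn
    refine h.trans_eq ?_
    rw [Nat.cast_add, Nat.cast_mul, Nat.cast_sub hn, Nat.cast_sub (by omega), Nat.cast_choose_two]
    push_cast
    ring
  · refine Asymptotics.IsBigO.of_bound (p : ℝ) ?_
    filter_upwards [Filter.eventually_ge_atTop p] with n hn
    rw [Real.norm_natCast, Real.norm_natCast]
    have h1 : p.choose 2 ≤ p * p := by
      rw [Nat.choose_two_right]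
      exact (Nat.div_le_self _ _).trans (Nat.mul_le_mul_left _ (Nat.sub_le _ _))
    have h2 : (n - p) * (p - 2) ≤ (n - p) * p := Nat.mul_le_mul_left _ (Nat.sub_le _ _)
    have h3 : p * p + (n - p) * p = p * n := by
      rw [← add_mul, Nat.add_sub_cancel' hn, mul_comm]
    have h4 : RainbowNumbers.rainbowNumber n H ≤ p * n := (hupper n hn).trans (by rw [← hpdef]; omega)
    exact_mod_cast h4
  · refine Asymptotics.IsBigO.of_bound (d : ℝ) ?_
    filter_upwards [Filter.eventually_ge_atTop p] with n hn
    rw [Real.norm_natCast, Real.norm_natCast]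
    have h1 : n ≤ d * ((n - 1) / d + 1) := by
      have := Nat.lt_mul_div_succ (n - 1) (b := d) (by omega)
      omega
    have h2 : n ≤ d * RainbowNumbers.rainbowNumber n H :=
      h1.trans (Nat.mul_le_mul_left _ (le_trans (Nat.le_add_left _ _) (hlower n hn)))
    exact_mod_cast h2
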